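/- **Setting.** Let $p,q\ge 1$ and let $\mathrm d\mu=(\mathrm d\mu_{b,a})$ be a $q\times p$ matrix of (complex, Borel) measures on $\mathbb R$ with finite moments. Let $X_{[m]}(x)=[I_m,\,xI_m,\,x^2I_m,\dots]^\top$ and let $\mathscr M=\int X_{[q]}\,\mathrm d\mu\,X_{[p]}^\top$ be the semi-infinite moment matrix. Assume that it has a Gauss–Borel ($LU$) factorization $\mathscr M=S^{-1}H\bar S^{-\top}$, with $S,\bar S$ lower unitriangular and $H$ diagonal and invertible, and let $B_n(x)$, $n\in\mathbb N_0$, be the rows of $B(x)=S X_{[q]}(x)$ (mixed-type multiple orthogonal polynomials on the step line). Let $R(x)=\sum_{k=0}^{N^R}R_kx^k\in\mathbb C^{p\times p}[x]$ and $L(x)=\sum_{k=0}^{N^L}L_kx^k\in\mathbb C^{q\times q}[x]$ be matrix polynomials such that, for some $r\in\{0,\dots,p-1\}$ and $l\in\{0,\dots,q-1\}$, $$R_{N^R}=\begin{bmatrix}0_{(p-r)\times r}&I_{p-r}\\0_{r\times r}&0_{r\times(p-r)}\end{bmatrix},\quad R_{N^R-1}=\begin{bmatrix}*&*\\I_r&*\end{bmatrix},\qquad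 L_{N^L}=\begin{bmatrix}0_{l\times(q-l)}&0_{l\times l}\\I_{q-l}&0_{(q-l)\times l}\end{bmatrix},\quad L_{N^L-1}=\begin{bmatrix}*&I_l\\ *&*\end{bmatrix}.$$ Assume that all zeros $\rho_1,\dots,\rho_{M^R}$ of $\det R$ and all zeros $\lambda_1,\dots,\lambda_{M^L}$ of $\det L$ are simple (so $M^R=N^Rp-r$ and $M^L=N^Lq-l$). Choose nonzero right eigenvectors $R(\rho_i)\vec r_i=0$ and $L(\lambda_j)\vec l_j=0$, and nonzero left eigenvectors $\overleftarrow r_iR(\rho_i)=0$. Assume that $\mathrm d\mu\,R^{-1}$ is a well-defined matrix of measures with finite moments: no $\mu_{b,a}$ charges a zero of $\det R$, and, writing $\mathrm d\mu=W\,\mathrm dm$ with $m$ a finite positive measure equivalent to $\sum_{a,b}|\mu_{b,a}|$, the entries of $x^kWR^{-1}$ are $m$-integrable for all $k\ge 0$. For arbitrary vector functions $\xi_1,\dots,\xi_{M^R}$ with values in $\mathbb C^q$, the Uvarov perturbation of $\mu$ is $$\mathrm d\tilde\mu(x)=L(x)\,\mathrm d\mu(x)\,R^{-1}(x)+\sum_{i=1}^{M^R}L(x)\xi_i(x)\overleftarrow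 r_i\,\delta(x-\rho_i),$$ with moment matrix $\tilde{\mathscr M}=\int X_{[q]}\,\mathrm d\tilde\mu\,X_{[p]}^\top$, where $\delta(x-\rho_i)$ acts on polynomials as evaluation at $\rho_i\in\mathbb C$. Put $$\mathbb B^{(j)}_n=B_n(\lambda_j)\vec l_j,\qquad \mathbb D^{(i)}_n=\int\frac{B_n(x)\,\mathrm d\mu(x)\,\vec r_i}{\rho_i-x},\qquad \mathbb W^{(i)}_n=B_n(\rho_i)\xi_i(\rho_i)\,\overleftarrow r_iR'(\rho_i)\vec r_i,$$ $$\mathbb I_{n,j}=\int B_n(x)\Big(\mathrm d\mu(x)R^{-1}(x)+\sum_{i=1}^{M^R}\xi_i(x)\overleftarrow r_i\,\delta(x-\rho_i)\Big)X_{[p]}^\top(x)e_j ,$$ where $e_0,e_1,\dots$ are the semi-infinite unit column vectors. For $n\ge M^R$ let $\tau_n$ be the determinant of order $M^L+M^R$ with rows $$\big[\mathbb B^{(1)}_m,\dots,\mathbb B^{(M^L)}_m,\ \mathbb D^{(1)}_m-\mathbb W^{(1)}_m,\dots,\mathbb D^{(M^R)}_m-\mathbb W^{(M^R)}_m\big],\qquad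 m=n-M^R,\dots,n+M^L-1,$$ and for $0\le n<M^R$ let $\tau_n$ be the determinant of order $M^L+n$ with rows $$\big[\mathbb B^{(1)}_m,\dots,\mathbb B^{(M^L)}_m,\ \mathbb I_{m,0},\dots,\mathbb I_{m,n-1}\big],\qquad m=0,\dots,M^L+n-1 .$$ **Theorem.** If the perturbed orthogonality exists, that is, if $\tilde{\mathscr M}$ also has a Gauss–Borel ($LU$) factorization $\tilde{\mathscr M}=\tilde S^{-1}\tilde H\tilde{\bar S}^{-\top}$ of the same kind, then $\tau_n\neq 0$ for every $n\ge M^R$. Moreover $\tau_n\ne0$ also for every $0\le n<M^R$; hence $\tau_n\neq0$ for all $n\in\mathbb N_0$. -/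

import Mathlib

open MeasureTheory Polynomial Matrix

noncomputable section

namespace Uvarov

/-! ### Matrices of measures -/

/-- A finite positive measure dominating all entries of a matrix of complex measures:
the sum of the total variations of their real and imaginary parts. -/
def refMeasure {p q : ℕ} (μ : Matrix (Fin q) (Fin p) (ComplexMeasure ℝ)) : Measure ℝ :=
  ∑ b, ∑ a, ((ComplexMeasure.re (μ b a)).totalVariation +
    (ComplexMeasure.im (μ b a)).totalVariation)

/-- The matrix density `W` of `μ` with respect to `refMeasure μ`, so that `dμ = W d(refMeasure μ)`
entrywise (see `withDensity_density`). -/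
def density {p q : ℕ} (μ : Matrix (Fin q) (Fin p) (ComplexMeasure ℝ)) (x : ℝ) :
    Matrix (Fin q) (Fin p) ℂ :=
  Matrix.of fun b a => ComplexMeasure.rnDeriv (μ b a) (refMeasure μ) x

instance {p q : ℕ} (μ : Matrix (Fin q) (Fin p) (ComplexMeasure ℝ)) :
    IsFiniteMeasure (refMeasure μ) := by
  unfold refMeasure SignedMeasure.totalVariation
  infer_instance

lemma totalVariation_le_refMeasure {p q : ℕ} (μ : Matrix (Fin q) (Fin p) (ComplexMeasure ℝ))
    (b : Fin q) (a : Fin p) :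
    (ComplexMeasure.re (μ b a)).totalVariation + (ComplexMeasure.im (μ b a)).totalVariation
      ≤ refMeasure μ := by
  unfold refMeasure
  refine le_trans ?_ (Finset.single_le_sum (f := fun b => ∑ a,
    ((ComplexMeasure.re (μ b a)).totalVariation + (ComplexMeasure.im (μ b a)).totalVariation))
    (fun _ _ => Measure.zero_le _) (Finset.mem_univ b))
  exact Finset.single_le_sum (f := fun a =>
    ((ComplexMeasure.re (μ b a)).totalVariation + (ComplexMeasure.im (μ b a)).totalVariation))
    (fun _ _ => Measure.zero_le _) (Finset.mem_univ a)

/-- `density μ` is indeed the density of the matrix of measures `μ`. -/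
lemma withDensity_density {p q : ℕ} (μ : Matrix (Fin q) (Fin p) (ComplexMeasure ℝ))
    (b : Fin q) (a : Fin p) :
    (refMeasure μ).withDensityᵥ (fun x => density μ x b a) = μ b a := by
  have hle := totalVariation_le_refMeasure μ b a
  have key : ∀ s : SignedMeasure ℝ, s.totalVariation ≤ refMeasure μ →
      (refMeasure μ).withDensityᵥ (s.rnDeriv (refMeasure μ)) = s := by
    intro s hs
    apply SignedMeasure.withDensityᵥ_rnDeriv_eq
    rw [SignedMeasure.absolutelyContinuous_ennreal_iff,
      VectorMeasure.ennrealToMeasure_toENNRealVectorMeasure]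
    exact Measure.absolutelyContinuous_of_le hs
  have hre := key (ComplexMeasure.re (μ b a)) (le_trans (Measure.le_add_right le_rfl) hle)
  have him := key (ComplexMeasure.im (μ b a)) (le_trans (Measure.le_add_left le_rfl) hle)
  have hint := ComplexMeasure.integrable_rnDeriv (μ b a) (refMeasure μ)
  ext i hi : 1
  change (refMeasure μ).withDensityᵥ (ComplexMeasure.rnDeriv (μ b a) (refMeasure μ)) i = _
  apply Complex.ext
  · rw [withDensityᵥ_apply hint hi, ← RCLike.re_eq_complex_re, ← integral_re hint.integrableOn]
    change ∫ x in i, (ComplexMeasure.re (μ b a)).rnDeriv (refMeasure μ) x ∂refMeasure μ = _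
    rw [← withDensityᵥ_apply (SignedMeasure.integrable_rnDeriv _ _) hi, hre]
    rfl
  · rw [withDensityᵥ_apply hint hi, ← RCLike.im_eq_complex_im, ← integral_im hint.integrableOn]
    change ∫ x in i, (ComplexMeasure.im (μ b a)).rnDeriv (refMeasure μ) x ∂refMeasure μ = _
    rw [← withDensityᵥ_apply (SignedMeasure.integrable_rnDeriv _ _) hi, him]
    rfl

/-! ### Moment matrices and Gauss--Borel factorization -/

/-- The semi-infinite matrix of monomials `X_[r](x)`, with the `r × r` blocks `x ^ k • I`:
row `k`, column `b`. -/
def monomialMatrix (r : ℕ) (x : ℂ) (k : ℕ) (b : Fin r) : ℂ :=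
  if k % r = (b : ℕ) then x ^ (k / r) else 0

/-- Evaluation of a matrix polynomial. -/
def evalAt {m n : ℕ} (A : Matrix (Fin m) (Fin n) ℂ[X]) (z : ℂ) : Matrix (Fin m) (Fin n) ℂ :=
  A.map (Polynomial.eval z)

/-- The moment matrix `∫ X_[q](x) dμ(x) X_[p](x)ᵀ`. -/
def momentMatrix {p q : ℕ} [NeZero p] [NeZero q]
    (μ : Matrix (Fin q) (Fin p) (ComplexMeasure ℝ)) (i j : ℕ) : ℂ :=
  ∫ x : ℝ, (x : ℂ) ^ (i / q + j / p) * density μ x (Fin.ofNat q i) (Fin.ofNat p j) ∂refMeasure μ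

/-- The moment matrix of the Uvarov perturbation
`dμ' = L dμ R⁻¹ + ∑ᵢ L ξᵢ rᵢ δ(x - ρᵢ)`, with `rᵢ` (`rcov i`) row vectors. -/
def perturbedMomentMatrix {p q MR : ℕ} [NeZero p] [NeZero q]
    (μ : Matrix (Fin q) (Fin p) (ComplexMeasure ℝ))
    (R : Matrix (Fin p) (Fin p) ℂ[X]) (L : Matrix (Fin q) (Fin q) ℂ[X])
    (ρ : Fin MR → ℂ) (rcov : Fin MR → Fin p → ℂ) (ξ : Fin MR → ℂ → Fin q → ℂ) (i j : ℕ) : ℂ :=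
  (∫ x : ℝ, (x : ℂ) ^ (i / q + j / p) *
      (evalAt L x * density μ x * (evalAt R x)⁻¹) (Fin.ofNat q i) (Fin.ofNat p j) ∂refMeasure μ) +
    ∑ s, ρ s ^ (i / q + j / p) *
      ((evalAt L (ρ s) *ᵥ ξ s (ρ s)) (Fin.ofNat q i) * rcov s (Fin.ofNat p j))

/-- `M = S⁻¹ H S'⁻ᵀ` with `S`, `S'` (`Sbar`) semi-infinite lower unitriangular matrices and `H` an
invertible diagonal matrix, written as `S M S'ᵀ = H`; all the sums involved are finite. -/
structure IsGaussBorel (M S Sbar : ℕ → ℕ → ℂ) (H : ℕ → ℂ) : Prop where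
  diag : ∀ i, S i i = 1
  lower : ∀ i j, i < j → S i j = 0
  diag_bar : ∀ i, Sbar i i = 1
  lower_bar : ∀ i j, i < j → Sbar i j = 0
  ne_zero : ∀ i, H i ≠ 0
  factor : ∀ i j, ∑ k ∈ Finset.range (i + 1), ∑ m ∈ Finset.range (j + 1),
    S i k * M k m * Sbar j m = if i = j then H i else 0

/-! ### Perturbing matrix polynomials -/

/-- `R` has degree `N`, with `R_N = [0, I_{p-r}; 0, 0]` and lower left `r × r` block of `R_{N-1}`
equal to `I_r`. (For `N = 0` the two conditions together force `r = 0`.) -/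
structure RightLeading {p : ℕ} (R : Matrix (Fin p) (Fin p) ℂ[X]) (N r : ℕ) : Prop where
  lt : r < p
  degree_le : ∀ i j, (R i j).natDegree ≤ N
  leading : ∀ i j : Fin p, (R i j).coeff N = if (j : ℕ) = i + r then 1 else 0
  subleading : ∀ i j : Fin p, p - r ≤ (i : ℕ) → (j : ℕ) < r →
    (R i j).coeff (N - 1) = if (i : ℕ) = j + (p - r) then 1 else 0

/-- `L` has degree `N`, with `L_N = [0, 0; I_{q-l}, 0]` and upper right `l × l` block of `L_{N-1}`
equal to `I_l`. (For `N = 0` the two conditions together force `l = 0`.) -/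
structure LeftLeading {q : ℕ} (L : Matrix (Fin q) (Fin q) ℂ[X]) (N l : ℕ) : Prop where
  lt : l < q
  degree_le : ∀ i j, (L i j).natDegree ≤ N
  leading : ∀ i j : Fin q, (L i j).coeff N = if (i : ℕ) = j + l then 1 else 0
  subleading : ∀ i j : Fin q, (i : ℕ) < l → q - l ≤ (j : ℕ) →
    (L i j).coeff (N - 1) = if (j : ℕ) = i + (q - l) then 1 else 0

/-- `ev` enumerates without repetition the eigenvalues of `A`, the zeros of `det A(x)`,
all of which are simple. -/
structure SimpleEigenvalues {d M : ℕ} (A : Matrix (Fin d) (Fin d) ℂ[X]) (ev : Fin M → ℂ) :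
    Prop where
  injective : Function.Injective ev
  isRoot_iff : ∀ z, A.det.IsRoot z ↔ ∃ i, ev i = z
  simple : ∀ i, A.det.rootMultiplicity (ev i) = 1

/-- `dμ R⁻¹` is a well-defined matrix of measures with finite moments: no entry of `μ` charges an
eigenvalue of `R`, and the entries of `x ^ k W(x) R(x)⁻¹` are integrable. -/
structure RightDivisible {p q : ℕ} (μ : Matrix (Fin q) (Fin p) (ComplexMeasure ℝ))
    (R : Matrix (Fin p) (Fin p) ℂ[X]) : Prop where
  ae_ne_zero : ∀ᵐ x : ℝ ∂refMeasure μ, (evalAt R x).det ≠ 0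
  integrable : ∀ (k : ℕ) (b : Fin q) (a : Fin p),
    Integrable (fun x : ℝ => (x : ℂ) ^ k * (density μ x * (evalAt R x)⁻¹) b a) (refMeasure μ)

/-! ### Orthogonal polynomials and tau determinants -/

/-- The row vector `B_n(x)`, the `n`-th row of `S X_[q](x)`. -/
def B (q : ℕ) (S : ℕ → ℕ → ℂ) (n : ℕ) (x : ℂ) : Fin q → ℂ :=
  fun b => ∑ k ∈ Finset.range (n + 1), S n k * monomialMatrix q x k b

/-- `𝔹_n^{(j)} = B_n(λ_j) l_j`. -/
def bbB {q ML : ℕ} (S : ℕ → ℕ → ℂ) (lam : Fin ML → ℂ) (lvec : Fin ML → Fin q → ℂ)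
    (n : ℕ) (j : Fin ML) : ℂ :=
  B q S n (lam j) ⬝ᵥ lvec j

/-- `𝔻_n^{(i)} = D_n(ρ_i) r_i = ∫ B_n(x) dμ(x) r_i / (ρ_i - x)`, with `r_i` (`rvec i`) a column
vector. -/
def bbD {p q MR : ℕ} (μ : Matrix (Fin q) (Fin p) (ComplexMeasure ℝ)) (S : ℕ → ℕ → ℂ)
    (ρ : Fin MR → ℂ) (rvec : Fin MR → Fin p → ℂ) (n : ℕ) (i : Fin MR) : ℂ :=
  ∫ x : ℝ, ((B q S n x ᵥ* density μ x) ⬝ᵥ rvec i) / (ρ i - x) ∂refMeasure μ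

/-- `𝕎_n^{(i)} = B_n(ρ_i) ξ_i(ρ_i) r'_i R'(ρ_i) r_i`, with `r'_i` (`rcov i`) a row vector and `r_i`
(`rvec i`) a column vector. -/
def bbW {p q MR : ℕ} (R : Matrix (Fin p) (Fin p) ℂ[X]) (S : ℕ → ℕ → ℂ) (ρ : Fin MR → ℂ)
    (rvec rcov : Fin MR → Fin p → ℂ) (ξ : Fin MR → ℂ → Fin q → ℂ) (n : ℕ) (i : Fin MR) : ℂ :=
  (B q S n (ρ i) ⬝ᵥ ξ i (ρ i)) *
    (rcov i ⬝ᵥ (evalAt (R.map Polynomial.derivative) (ρ i) *ᵥ rvec i))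

/-- `𝕀_{n,j} = ∫ B_n(x) (dμ(x) R(x)⁻¹ + ∑ᵢ ξ_i(x) r'_i δ(x - ρ_i)) X_[p](x)ᵀ e_j`. -/
def bbI {p q MR : ℕ} (μ : Matrix (Fin q) (Fin p) (ComplexMeasure ℝ))
    (R : Matrix (Fin p) (Fin p) ℂ[X]) (S : ℕ → ℕ → ℂ) (ρ : Fin MR → ℂ)
    (rcov : Fin MR → Fin p → ℂ) (ξ : Fin MR → ℂ → Fin q → ℂ) (n j : ℕ) : ℂ :=
  (∫ x : ℝ, (B q S n x ᵥ* (density μ x * (evalAt R x)⁻¹)) ⬝ᵥ monomialMatrix p x j ∂refMeasure μ) +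
    ∑ i, (B q S n (ρ i) ⬝ᵥ ξ i (ρ i)) * (rcov i ⬝ᵥ monomialMatrix p (ρ i) j)

/-- The determinant `τ_n` for `n ≥ MR`: its rows are
`[𝔹_m^{(1)}, …, 𝔹_m^{(ML)}, 𝔻_m^{(1)} - 𝕎_m^{(1)}, …, 𝔻_m^{(MR)} - 𝕎_m^{(MR)}]` for
`m = n - MR, …, n + ML - 1`. -/
def tau {p q MR ML : ℕ} (μ : Matrix (Fin q) (Fin p) (ComplexMeasure ℝ))
    (R : Matrix (Fin p) (Fin p) ℂ[X]) (S : ℕ → ℕ → ℂ)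
    (ρ : Fin MR → ℂ) (lam : Fin ML → ℂ) (rvec rcov : Fin MR → Fin p → ℂ)
    (lvec : Fin ML → Fin q → ℂ) (ξ : Fin MR → ℂ → Fin q → ℂ) (n : ℕ) : ℂ :=
  Matrix.det (Matrix.of fun k c : Fin (ML + MR) =>
    Fin.append (fun j => bbB S lam lvec (n - MR + k) j)
      (fun i => bbD μ S ρ rvec (n - MR + k) i - bbW R S ρ rvec rcov ξ (n - MR + k) i) c)

/-- The determinant `τ_n` for `n < MR`: its rows are
`[𝔹_m^{(1)}, …, 𝔹_m^{(ML)}, 𝕀_{m,0}, …, 𝕀_{m,n-1}]` for `m = 0, …, ML + n - 1`. -/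
def tauSmall {p q MR ML : ℕ} (μ : Matrix (Fin q) (Fin p) (ComplexMeasure ℝ))
    (R : Matrix (Fin p) (Fin p) ℂ[X]) (S : ℕ → ℕ → ℂ)
    (ρ : Fin MR → ℂ) (lam : Fin ML → ℂ) (rcov : Fin MR → Fin p → ℂ)
    (lvec : Fin ML → Fin q → ℂ) (ξ : Fin MR → ℂ → Fin q → ℂ) (n : ℕ) : ℂ :=
  Matrix.det (Matrix.of fun k c : Fin (ML + n) =>
    Fin.append (fun j => bbB S lam lvec k j) (fun j : Fin n => bbI μ R S ρ rcov ξ k j) c)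

end Uvarov

end

/-! Everything is read off one bilinear form Φ on vector polynomials, `uvarovPairing`, given by dμ
R⁻¹ + ∑ ξᵢ rᵢ δ(x - ρᵢ). Multiplying the right argument by R cancels R⁻¹ and, since the rᵢ are left
eigenvectors, kills the masses; so Φ(·, R ·) has the moments of μ, while Φ(· L, ·) has those of the
perturbation.

If τ_n = 0, a nonzero vector in the left kernel gives a combination P of consecutive B_m, of
step-line order at most n + ML. The first ML columns say P(λⱼ) lⱼ = 0. As the zeros of det L are
simple, this forces P = Q L (`SimpleEigenvalues.exists_eq_vecMul`), and the leading form of L places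
Q in the span of the first n monomials.

The other columns give Φ(P, x) = 0 for the first n monomials x. For n < MR they are these pairings.
For n ≥ MR the column 𝔻 - 𝕎 is, up to sign, the pairing with the quotient R rᵢ / (x - ρᵢ), and P is
also orthogonal to R g for g of order at most n - MR; together such vectors span all orders up to n
(`pairing_eq_zero_of_eigenQuotient`).

Hence the coefficients of Q lie in the left kernel of the n × n truncation of the perturbed moment
matrix, which is invertible by its LU factorization. So Q = 0 and P = 0, against the independence of
the B_m. -/

namespace Uvarov

/-! ### The step-line order on vector polynomials -/

/-- Evaluation of a vector polynomial. -/
noncomputable def evalVec {n : ℕ} (P : Fin n → ℂ[X]) (z : ℂ) : Fin n → ℂ := fun b => (P b).eval z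

/-- The `k`-th vector monomial in the step-line order. -/
noncomputable def monomialVec (q k : ℕ) : Fin q → ℂ[X] :=
  fun b => if k % q = (b : ℕ) then X ^ (k / q) else 0

/-- The `k`-th coordinate of a vector polynomial in the step-line order. -/
noncomputable def stepCoord (q : ℕ) [NeZero q] (k : ℕ) : (Fin q → ℂ[X]) →ₗ[ℂ] ℂ :=
  (lcoeff ℂ (k / q)).comp (LinearMap.proj (Fin.ofNat q k))

/-- The vector polynomials in the span of the first `n` vector monomials. -/
noncomputable def stepSpace (q : ℕ) [NeZero q] (n : ℕ) : Submodule ℂ (Fin q → ℂ[X]) :=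
  ⨅ (k : ℕ) (_ : n ≤ k), LinearMap.ker (stepCoord q k)

lemma RightLeading.transpose {q : ℕ} {R : Matrix (Fin q) (Fin q) ℂ[X]} {N r : ℕ}
    (h : RightLeading R N r) : LeftLeading Rᵀ N r where
  lt := h.lt
  degree_le i j := h.degree_le j i
  leading i j := h.leading j i
  subleading i j hi hj := h.subleading j i hj hi

section Step

variable {q : ℕ} [NeZero q]

lemma mem_stepSpace {n : ℕ} {P : Fin q → ℂ[X]} :
    P ∈ stepSpace q n ↔ ∀ k, n ≤ k → stepCoord q k P = 0 := by
  simp [stepSpace]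

lemma stepCoord_apply (k : ℕ) (P : Fin q → ℂ[X]) :
    stepCoord q k P = (P (Fin.ofNat q k)).coeff (k / q) := rfl

lemma stepCoord_mul_add (P : Fin q → ℂ[X]) (k : ℕ) (b : Fin q) :
    stepCoord q (k * q + b) P = (P b).coeff k := by
  have hq : 0 < q := NeZero.pos q
  have h1 : (k * q + b) / q = k := by
    rw [mul_comm, Nat.mul_add_div hq, Nat.div_eq_of_lt b.2, add_zero]
  have h2 : Fin.ofNat q (k * q + b) = b := by
    ext
    simp [Fin.ofNat, Nat.mod_eq_of_lt b.2]
  rw [stepCoord_apply, h1, h2]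

lemma ext_stepCoord {P Q : Fin q → ℂ[X]} (h : ∀ k, stepCoord q k P = stepCoord q k Q) : P = Q := by
  ext b k
  rw [← stepCoord_mul_add, h, stepCoord_mul_add]

lemma mem_stepSpace_iff_coeff {n : ℕ} {P : Fin q → ℂ[X]} :
    P ∈ stepSpace q n ↔ ∀ (b : Fin q) k, n ≤ k * q + b → (P b).coeff k = 0 := by
  rw [mem_stepSpace]
  constructor
  · intro h b k hk
    rw [← stepCoord_mul_add]
    exact h _ hk
  · intro h k hk
    rw [stepCoord_apply]
    apply h
    simpa [Fin.ofNat, Nat.div_add_mod'] using hk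

lemma stepCoord_monomialVec (k m : ℕ) :
    stepCoord q k (monomialVec q m) = if k = m then 1 else 0 := by
  rw [stepCoord_apply, monomialVec]
  by_cases h : k = m
  · subst h
    simp [Fin.ofNat]
  · simp only [Fin.ofNat, h, if_false]
    split_ifs with h1
    · rw [coeff_X_pow, if_neg]
      intro h2
      apply h
      rw [← Nat.div_add_mod k q, ← Nat.div_add_mod m q, h1, h2]
    · simp

lemma stepSpace_mono {m n : ℕ} (h : m ≤ n) : stepSpace q m ≤ stepSpace q n := by
  intro P hP
  rw [mem_stepSpace] at hP ⊢
  exact fun k hk => hP k (h.trans hk)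

lemma exists_mem_stepSpace (P : Fin q → ℂ[X]) (n : ℕ) : ∃ s, P ∈ stepSpace q (n + s) := by
  refine ⟨(∑ b, (P b).natDegree + 1) * q, mem_stepSpace_iff_coeff.2 fun b k hk => ?_⟩
  apply coeff_eq_zero_of_natDegree_lt
  have h1 : (P b).natDegree ≤ ∑ b, (P b).natDegree :=
    Finset.single_le_sum (f := fun b => (P b).natDegree) (fun _ _ => Nat.zero_le _)
      (Finset.mem_univ b)
  by_contra! h
  have h2 : (k + 1) * q ≤ (∑ b, (P b).natDegree + 1) * q := Nat.mul_le_mul_right _ (by omega)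
  have := b.2
  rw [add_mul k] at h2
  omega

lemma eq_sum_stepCoord {n : ℕ} {P : Fin q → ℂ[X]} (hP : P ∈ stepSpace q n) :
    P = ∑ k ∈ Finset.range n, stepCoord q k P • monomialVec q k := by
  refine ext_stepCoord fun j => ?_
  simp only [map_sum, map_smul, stepCoord_monomialVec, smul_eq_mul, mul_ite, mul_one, mul_zero,
    Finset.sum_ite_eq, Finset.mem_range]
  split_ifs with h
  · rfl
  · exact mem_stepSpace.1 hP j (not_lt.1 h)

lemma monomialVec_mem_stepSpace {k n : ℕ} (h : k < n) : monomialVec q k ∈ stepSpace q n := by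
  rw [mem_stepSpace]
  intro j hj
  rw [stepCoord_monomialVec, if_neg (by omega)]

/-- A linear factor raises the degree of each nonzero entry by exactly one, which is q places on the
step line. -/
lemma mem_stepSpace_of_X_sub_C_smul {n : ℕ} {z : ℂ} {P : Fin q → ℂ[X]}
    (h : (fun b => (X - C z) * P b) ∈ stepSpace q (n + q)) : P ∈ stepSpace q n := by
  rw [mem_stepSpace_iff_coeff] at h ⊢
  intro b k hk
  by_cases h0 : P b = 0
  · simp [h0]
  · apply coeff_eq_zero_of_natDegree_lt
    by_contra! hle
    have h1 : ((X - C z) * P b).natDegree = (P b).natDegree + 1 := by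
      rw [natDegree_mul (X_sub_C_ne_zero z) h0, natDegree_X_sub_C, add_comm]
    have h2 := h b ((P b).natDegree + 1) (by
      have := Nat.mul_le_mul_right q hle
      rw [add_mul]
      omega)
    rw [← h1] at h2
    exact mul_ne_zero (X_sub_C_ne_zero z) h0 (leadingCoeff_eq_zero.1 h2)

/-! ### Matrix polynomials shifting the step-line order -/

/-- Multiplication of row vectors by `L` shifts the step-line order by exactly `d`. -/
def ShiftsBy (L : Matrix (Fin q) (Fin q) ℂ[X]) (d : ℕ) : Prop :=
  ∀ (i j : Fin q) (e : ℕ), i + d ≤ e * q + j →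
    (L i j).coeff e = if e * q + j = i + d then 1 else 0

/-- The ones prescribed in L_N and in L_{N-1} both lie on the single diagonal e q + j = i + (N q -
l); beyond it all coefficients vanish. -/
lemma LeftLeading.shiftsBy {L : Matrix (Fin q) (Fin q) ℂ[X]} {N l : ℕ} (h : LeftLeading L N l) :
    ShiftsBy L (N * q - l) := by
  intro i j e he
  have hl := h.lt
  have hi := i.2
  have hj := j.2
  -- For N = 0 truncated subtraction gives N - 1 = N, so if l > 0 the two conditions prescribe 0 and
  -- 1 for the same coefficient, at position (0, q - l).
  have hN : N = 0 → l = 0 := by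
    intro hN
    by_contra hl0
    have h1 := h.leading ⟨0, by omega⟩ ⟨q - l, by omega⟩
    have h2 := h.subleading ⟨0, by omega⟩ ⟨q - l, by omega⟩ (by simp; omega) le_rfl
    subst hN
    simp at h1 h2
    rw [h2, if_neg (by omega)] at h1
    exact one_ne_zero h1
  rcases lt_trichotomy e N with heN | heN | heN
  · have h1 : (e + 1) * q ≤ N * q := Nat.mul_le_mul_right _ heN
    rw [add_mul] at h1
    -- Since l < q, the hypothesis `he` leaves only e = N - 1 below N, and there it confines (i, j)
    -- to the upper right l × l block.
    have h2 : (e + 1) * q = N * q := by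
      by_contra hne
      have h3 : e + 1 < N := by
        rcases Nat.lt_or_ge (e + 1) N with h | h
        · exact h
        · exact absurd (by rw [show e + 1 = N by omega]) hne
      have h4 : (e + 2) * q ≤ N * q := Nat.mul_le_mul_right _ h3
      rw [add_mul] at h4
      omega
    have h3 : e = N - 1 := by
      have := Nat.eq_of_mul_eq_mul_right (by omega) h2
      omega
    rw [add_mul] at h2
    rw [h3, h.subleading i j (by omega) (by omega), ← h3]
    congr 1
    apply propext
    omega
  · subst heN
    rw [h.leading]
    congr 1
    apply propext
    rcases Nat.eq_zero_or_pos e with h0 | h0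
    · rw [h0, hN h0]
      omega
    · have := Nat.le_mul_of_pos_left q h0
      omega
  · have h1 : (N + 1) * q ≤ e * q := Nat.mul_le_mul_right _ heN
    rw [add_mul] at h1
    rw [coeff_eq_zero_of_natDegree_lt ((h.degree_le i j).trans_lt heN), if_neg]
    rcases Nat.eq_zero_or_pos N with h0 | h0
    · have := hN h0
      subst h0
      omega
    · have := Nat.le_mul_of_pos_left q h0
      omega

lemma monomialVec_vecMul (L : Matrix (Fin q) (Fin q) ℂ[X]) (k : ℕ) (b : Fin q) :
    (monomialVec q k ᵥ* L) b = X ^ (k / q) * L (Fin.ofNat q k) b := by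
  rw [vecMul, dotProduct, Finset.sum_eq_single (Fin.ofNat q k)]
  · simp [monomialVec, Fin.ofNat]
  · intro c _ hc
    rw [monomialVec, if_neg, zero_mul]
    intro h
    exact hc (by ext; simp [Fin.ofNat, h])
  · simp

variable {L : Matrix (Fin q) (Fin q) ℂ[X]} {d : ℕ}

lemma ShiftsBy.stepCoord_monomialVec_vecMul (hL : ShiftsBy L d) {k t : ℕ} (hkt : k ≤ t) :
    stepCoord q (t + d) (monomialVec q k ᵥ* L) = if k = t then 1 else 0 := by
  have hdiv : k / q ≤ (t + d) / q := Nat.div_le_div_right (by omega)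
  rw [stepCoord_apply, monomialVec_vecMul, coeff_X_pow_mul', if_pos hdiv]
  have h1 : (k / q) * q + k % q = k := Nat.div_add_mod' k q
  have h2 : ((t + d) / q) * q + (t + d) % q = t + d := Nat.div_add_mod' (t + d) q
  have h3 : ((t + d) / q - k / q) * q = ((t + d) / q) * q - (k / q) * q := Nat.sub_mul _ _ _
  have h4 : (k / q) * q ≤ ((t + d) / q) * q := Nat.mul_le_mul_right _ hdiv
  have h5 : (Fin.ofNat q k : ℕ) = k % q := rfl
  have h6 : (Fin.ofNat q (t + d) : ℕ) = (t + d) % q := rfl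
  rw [hL _ _ _ (by omega)]
  congr 1
  apply propext
  omega

lemma ShiftsBy.stepCoord_vecMul (hL : ShiftsBy L d) {t : ℕ} {Q : Fin q → ℂ[X]}
    (hQ : Q ∈ stepSpace q (t + 1)) : stepCoord q (t + d) (Q ᵥ* L) = stepCoord q t Q := by
  conv_lhs => rw [eq_sum_stepCoord hQ]
  rw [sum_vecMul, map_sum, Finset.sum_congr rfl (g := fun k => stepCoord q k Q *
    if k = t then 1 else 0)]
  · simp
  · intro k hk
    rw [smul_vecMul, map_smul, smul_eq_mul,
      hL.stepCoord_monomialVec_vecMul (by rw [Finset.mem_range] at hk; omega)]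

/-- The top coordinate of Q reappears unchanged d places higher in Q L, so it cannot cancel.
Starting from some finite order of Q, the excess over n - d is removed one coordinate at a time. -/
lemma ShiftsBy.mem_stepSpace (hL : ShiftsBy L d) {n : ℕ} {Q : Fin q → ℂ[X]}
    (hQ : Q ᵥ* L ∈ stepSpace q n) : Q ∈ stepSpace q (n - d) := by
  obtain ⟨s, hs⟩ := exists_mem_stepSpace Q (n - d)
  induction s with
  | zero => exact hs
  | succ s ih =>
    apply ih
    rw [Uvarov.mem_stepSpace] at hs ⊢
    intro k hk
    rcases hk.eq_or_lt with h | h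
    · subst h
      exact (hL.stepCoord_vecMul (t := n - d + s) (Uvarov.mem_stepSpace.2 hs)).symm.trans
        (Uvarov.mem_stepSpace.1 hQ _ (by omega))
    · exact hs k h

/-- In a nonzero term of the Leibniz expansion, q deg L_{σ(i),i} + i ≤ σ(i) + d. Summed over i, the
indices cancel and the total degree is at most d. -/
lemma ShiftsBy.natDegree_det_le (hL : ShiftsBy L d) : L.det.natDegree ≤ d := by
  have hq : 0 < q := NeZero.pos q
  rw [det_apply]
  refine natDegree_sum_le_of_forall_le _ _ fun σ _ => ?_
  refine (natDegree_smul_le _ _).trans ?_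
  by_cases h0 : ∏ i, L (σ i) i = 0
  · rw [h0]
    simp
  have hne : ∀ i, L (σ i) i ≠ 0 := fun i => Finset.prod_ne_zero_iff.1 h0 i (Finset.mem_univ i)
  refine (natDegree_prod_le _ _).trans ?_
  have h1 : ∀ i, (L (σ i) i).natDegree * q + i ≤ (σ i : ℕ) + d := by
    intro i
    by_contra! h
    have := hL (σ i) i _ h.le
    rw [if_neg (by omega)] at this
    exact hne i (leadingCoeff_eq_zero.1 this)
  have h2 := Finset.sum_le_sum fun i (_ : i ∈ Finset.univ) => h1 i
  rw [Finset.sum_add_distrib, Finset.sum_add_distrib, ← Finset.sum_mul,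
    Equiv.sum_comp σ (fun i : Fin q => (i : ℕ))] at h2
  simp only [Finset.sum_const, Finset.card_univ, Fintype.card_fin, smul_eq_mul] at h2
  rw [mul_comm q d, add_comm] at h2
  exact Nat.le_of_mul_le_mul_right (Nat.le_of_add_le_add_left h2) hq

lemma ShiftsBy.mulVec_C_mem_stepSpace (hL : ShiftsBy L d) (w : Fin q → ℂ) :
    (Lᵀ *ᵥ fun i => C (w i)) ∈ stepSpace q (d + q) := by
  rw [mem_stepSpace_iff_coeff]
  intro b k hk
  rw [mulVec, dotProduct, finsetSum_coeff]
  refine Finset.sum_eq_zero fun i _ => ?_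
  have := i.2
  rw [coeff_mul_C, transpose_apply, hL _ _ _ (by omega), if_neg (by omega), zero_mul]

end Step

/-! ### Matrix polynomials with simple eigenvalues -/

section Eigen

variable {d : ℕ} {A : Matrix (Fin d) (Fin d) ℂ[X]}

lemma evalVec_mulVec (A : Matrix (Fin d) (Fin d) ℂ[X]) (P : Fin d → ℂ[X]) (z : ℂ) :
    evalVec (A *ᵥ P) z = evalAt A z *ᵥ evalVec P z := by
  ext b
  simp [evalVec, evalAt, mulVec, dotProduct, eval_finsetSum]

lemma evalVec_vecMul (A : Matrix (Fin d) (Fin d) ℂ[X]) (P : Fin d → ℂ[X]) (z : ℂ) :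
    evalVec (P ᵥ* A) z = evalVec P z ᵥ* evalAt A z := by
  ext b
  simp [evalVec, evalAt, vecMul, dotProduct, eval_finsetSum]

lemma evalVec_C (w : Fin d → ℂ) (z : ℂ) : evalVec (fun i => C (w i)) z = w := by
  ext b
  simp [evalVec]

/-- The polynomial quotient `A w / (X - z)` for an eigenvector `w` with eigenvalue `z`. -/
noncomputable def eigenQuotient (A : Matrix (Fin d) (Fin d) ℂ[X]) (z : ℂ) (w : Fin d → ℂ) :
    Fin d → ℂ[X] :=
  fun b => (A *ᵥ fun i => C (w i)) b /ₘ (X - C z)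

lemma X_sub_C_mul_eigenQuotient {z : ℂ} {w : Fin d → ℂ} (h : evalAt A z *ᵥ w = 0) (b : Fin d) :
    (X - C z) * eigenQuotient A z w b = (A *ᵥ fun i => C (w i)) b := by
  rw [eigenQuotient, mul_divByMonic_eq_iff_isRoot, IsRoot]
  have := congrFun (evalVec_mulVec A (fun i => C (w i)) z) b
  rw [evalVec_C, h] at this
  exact this

lemma det_updateCol_mulVec (A : Matrix (Fin d) (Fin d) ℂ[X]) (w : Fin d → ℂ[X]) (j : Fin d) :
    (A.updateCol j (A *ᵥ w)).det = w j * A.det := by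
  rw [← smul_eq_mul, ← det_updateCol_sum A j w]
  congr 2
  ext k
  simp [mulVec, dotProduct, mul_comm]

/-- A simple zero of the determinant has a one-dimensional kernel. Otherwise there is a second
kernel vector u with uᵢ = 0, where wᵢ ≠ 0. Replacing columns i and j by A w and A u multiplies the
determinant by the nonzero constant wᵢ uⱼ, yet both new columns are divisible by X - z, so (X - z)²
divides det A. -/
lemma eq_smul_of_rootMultiplicity_det_eq_one {z : ℂ} (hz : A.det.rootMultiplicity z = 1)
    {w v : Fin d → ℂ} (hw0 : w ≠ 0) (hw : evalAt A z *ᵥ w = 0) (hv : evalAt A z *ᵥ v = 0) :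
    ∃ c : ℂ, v = c • w := by
  obtain ⟨i, hi⟩ := Function.ne_iff.1 hw0
  refine ⟨v i / w i, ?_⟩
  by_contra hne
  set u := v - (v i / w i) • w with hu
  have hu0 : u ≠ 0 := fun h => hne (sub_eq_zero.1 h)
  have hui : u i = 0 := by
    have : w i ≠ 0 := hi
    simp [hu]
    field_simp
    simp
  have huA : evalAt A z *ᵥ u = 0 := by
    rw [hu, mulVec_sub, mulVec_smul, hw, hv, smul_zero, sub_zero]
  obtain ⟨j, hj⟩ := Function.ne_iff.1 hu0
  have hji : j ≠ i := fun h => hj (by rw [h, hui]; rfl)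
  set A1 := A.updateCol i (A *ᵥ fun k => C (w k)) with hA1
  have e1 : A1.det = C (w i) * A.det := det_updateCol_mulVec A _ i
  -- Because uᵢ = 0, the modified column i does not contribute: A1 u = A u.
  have e2 : (A1.updateCol j (A *ᵥ fun k => C (u k))).det = C (u j) * A1.det := by
    rw [← det_updateCol_mulVec A1 (fun k => C (u k)) j]
    congr 2
    ext1 b
    simp only [mulVec, dotProduct]
    refine Finset.sum_congr rfl fun k _ => ?_
    by_cases hk : k = i
    · simp [hk, hui]
    · rw [hA1, updateCol_ne hk]
  have q1 : (A *ᵥ fun k => C (w k)) = (X - C z) • eigenQuotient A z w :=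
    funext fun b => (X_sub_C_mul_eigenQuotient hw b).symm
  have q2 : (A *ᵥ fun k => C (u k)) = (X - C z) • eigenQuotient A z u :=
    funext fun b => (X_sub_C_mul_eigenQuotient huA b).symm
  rw [e1, q2, det_updateCol_smul, hA1, updateCol_comm _ hji.symm, q1, det_updateCol_smul] at e2
  have hdvd : (X - C z) ^ 2 ∣ A.det := by
    have : (X - C z) ^ 2 ∣ C (u j * w i) * A.det := by
      rw [C_mul, mul_assoc, ← e2, sq]
      exact mul_dvd_mul_left _ (dvd_mul_right _ _)
    exact (isUnit_C.2 (mul_ne_zero hj hi).isUnit).dvd_mul_left.1 this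
  have hdet : A.det ≠ 0 := by
    intro h
    simp [h] at hz
  have := (le_rootMultiplicity_iff hdet).2 hdvd
  omega

variable {M : ℕ} {ev : Fin M → ℂ}

lemma SimpleEigenvalues.det_ne_zero (h : SimpleEigenvalues A ev) : A.det ≠ 0 := by
  intro h0
  have hsurj : Function.Surjective ev := fun z => (h.isRoot_iff z).1 (by simp [h0])
  exact not_finite_iff_infinite.2 (inferInstance : Infinite ℂ) (Finite.of_surjective ev hsurj)

lemma SimpleEigenvalues.card_le (h : SimpleEigenvalues A ev) : M ≤ A.det.natDegree := by
  have h1 : (Finset.univ.map ⟨ev, h.injective⟩).val ⊆ A.det.roots := by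
    intro z hz
    rw [mem_roots h.det_ne_zero, h.isRoot_iff]
    simpa using hz
  simpa using card_le_degree_of_subset_roots h1

/-- Over ℂ the determinant splits, with the listed eigenvalues as its distinct simple roots. -/
lemma SimpleEigenvalues.det_dvd (h : SimpleEigenvalues A ev) {f : ℂ[X]}
    (hf : ∀ i, f.eval (ev i) = 0) : A.det ∣ f := by
  by_cases f0 : f = 0
  · simp [f0]
  refine (IsAlgClosed.splits A.det).dvd_of_roots_le_roots h.det_ne_zero ?_
  have hnd : A.det.roots.Nodup := by
    rw [Multiset.nodup_iff_count_le_one]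
    intro z
    rw [count_roots]
    by_cases hz : A.det.IsRoot z
    · obtain ⟨i, rfl⟩ := (h.isRoot_iff z).1 hz
      exact (h.simple i).le
    · rw [rootMultiplicity_eq_zero hz]
      exact zero_le_one
  rw [Multiset.le_iff_subset hnd]
  intro z hz
  rw [mem_roots h.det_ne_zero, h.isRoot_iff] at hz
  obtain ⟨i, rfl⟩ := hz
  rw [mem_roots f0]
  exact hf i

lemma SimpleEigenvalues.evalAt_mulVec_adjugate (h : SimpleEigenvalues A ev) (i : Fin M)
    (P : Fin d → ℂ[X]) : evalAt A (ev i) *ᵥ evalVec (A.adjugate *ᵥ P) (ev i) = 0 := by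
  rw [← evalVec_mulVec, mulVec_mulVec, mul_adjugate, smul_mulVec, one_mulVec]
  ext b
  have : A.det.eval (ev i) = 0 := (h.isRoot_iff _).2 ⟨i, rfl⟩
  simp [evalVec, this]

/-- The candidate is Q = P adj(A) / det A. At an eigenvalue the columns of adj(A) lie in the kernel
of A, hence are multiples of the eigenvector, so P adj(A) vanishes there and the division is exact.
-/
lemma SimpleEigenvalues.exists_eq_vecMul (h : SimpleEigenvalues A ev) {w : Fin M → Fin d → ℂ}
    (hw : ∀ i, w i ≠ 0 ∧ evalAt A (ev i) *ᵥ w i = 0) {P : Fin d → ℂ[X]}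
    (hP : ∀ i, evalVec P (ev i) ⬝ᵥ w i = 0) : ∃ Q : Fin d → ℂ[X], P = Q ᵥ* A := by
  have hdvd : ∀ b, A.det ∣ (P ᵥ* A.adjugate) b := by
    intro b
    refine h.det_dvd fun i => ?_
    obtain ⟨c, hc⟩ := eq_smul_of_rootMultiplicity_det_eq_one (h.simple i) (hw i).1 (hw i).2
      (h.evalAt_mulVec_adjugate i (Pi.single b 1))
    have h1 : (P ᵥ* A.adjugate) b = P ⬝ᵥ (A.adjugate *ᵥ Pi.single b 1) := by
      rw [dotProduct_mulVec, dotProduct_single_one]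
    have h2 : ((P ᵥ* A.adjugate) b).eval (ev i) =
        evalVec P (ev i) ⬝ᵥ evalVec (A.adjugate *ᵥ Pi.single b 1) (ev i) := by
      rw [h1]
      simp only [dotProduct, eval_finsetSum, eval_mul, evalVec]
    rw [h2, hc, dotProduct_smul, hP, smul_zero]
  choose Q hQ using hdvd
  refine ⟨Q, ?_⟩
  have h1 : P ᵥ* A.adjugate = A.det • Q := funext hQ
  have h2 : A.det • P = A.det • (Q ᵥ* A) := by
    rw [← smul_vecMul, ← h1, vecMul_vecMul, adjugate_mul, vecMul_smul, vecMul_one]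
  exact smul_right_injective _ h.det_ne_zero h2

/-- This is the partial fraction expansion of A⁻¹ f = adj(A) f / det A: the poles are simple with
residues proportional to the eigenvectors, and the polynomial part is g. Multiplying back by A turns
wᵢ / (X - evᵢ) into `eigenQuotient`. -/
lemma SimpleEigenvalues.exists_eq_sum_add_mulVec (h : SimpleEigenvalues A ev)
    {w : Fin M → Fin d → ℂ} (hw : ∀ i, w i ≠ 0 ∧ evalAt A (ev i) *ᵥ w i = 0)
    (f : Fin d → ℂ[X]) : ∃ (c : Fin M → ℂ) (g : Fin d → ℂ[X]),
      f = ∑ i, c i • eigenQuotient A (ev i) (w i) + A *ᵥ g := by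
  have hroot : ∀ i, A.det.IsRoot (ev i) := fun i => (h.isRoot_iff _).2 ⟨i, rfl⟩
  -- By simplicity Dᵢ is nonzero at its own eigenvalue and zero at the others, so the Dᵢ serve as
  -- unnormalized Lagrange interpolation polynomials.
  set D : Fin M → ℂ[X] := fun i => A.det /ₘ (X - C (ev i)) with hD
  have hDX : ∀ i, (X - C (ev i)) * D i = A.det := fun i => mul_divByMonic_eq_iff_isRoot.2 (hroot i)
  have hDi : ∀ i, (D i).eval (ev i) ≠ 0 := by
    intro i h0
    obtain ⟨E, hE⟩ := dvd_iff_isRoot.2 h0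
    have hdvd : (X - C (ev i)) ^ 2 ∣ A.det := ⟨E, by rw [← hDX i, hE]; ring⟩
    have := (le_rootMultiplicity_iff h.det_ne_zero).2 hdvd
    have := h.simple i
    omega
  have hDk : ∀ i k, i ≠ k → (D i).eval (ev k) = 0 := by
    intro i k hik
    have h1 := congrArg (eval (ev k)) (hDX i)
    rw [eval_mul, (hroot k : A.det.eval (ev k) = 0), mul_eq_zero] at h1
    refine h1.resolve_left fun h2 => hik (h.injective ?_)
    simp only [eval_sub, eval_X, eval_C, sub_eq_zero] at h2
    exact h2.symm
  choose c hc using fun i => eq_smul_of_rootMultiplicity_det_eq_one (h.simple i) (hw i).1 (hw i).2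
      (h.evalAt_mulVec_adjugate i f)
  set c' : Fin M → ℂ := fun i => c i / (D i).eval (ev i) with hc'
  have hdvd : ∀ b, A.det ∣ (A.adjugate *ᵥ f) b - ∑ i, C (c' i * w i b) * D i := by
    intro b
    refine h.det_dvd fun k => ?_
    have h1 : ((A.adjugate *ᵥ f) b).eval (ev k) = c k * w k b := congrFun (hc k) b
    rw [eval_sub, h1, eval_finsetSum, Finset.sum_eq_single k]
    · rw [eval_mul, eval_C, hc']
      field_simp [hDi k]
      ring
    · intro i _ hik
      rw [eval_mul, hDk i k hik, mul_zero]
    · simp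
  choose g hg using hdvd
  refine ⟨c', g, smul_right_injective _ h.det_ne_zero ?_⟩
  have h1 : A.adjugate *ᵥ f = (∑ i, (c' i) • D i • fun k => C (w i k)) + A.det • g := by
    ext1 b
    have := hg b
    rw [sub_eq_iff_eq_add] at this
    rw [this, add_comm]
    simp [Finset.sum_apply, smul_eq_C_mul, mul_comm, mul_assoc, mul_left_comm]
  have h2 : A.det • f = A *ᵥ (A.adjugate *ᵥ f) := by
    rw [mulVec_mulVec, mul_adjugate, smul_mulVec, one_mulVec]
  have h3 : ∀ i, A *ᵥ ((c' i) • D i • fun k => C (w i k)) =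
      A.det • (c' i) • eigenQuotient A (ev i) (w i) := by
    intro i
    rw [mulVec_smul, mulVec_smul, smul_comm A.det]
    congr 1
    ext1 b
    rw [Pi.smul_apply, Pi.smul_apply, ← X_sub_C_mul_eigenQuotient (hw i).2, ← hDX i, smul_eq_mul,
      smul_eq_mul]
    ring
  change A.det • f = A.det • _
  rw [h2, h1, mulVec_add, mulVec_smul, smul_add, Finset.smul_sum]
  congr 1
  rw [mulVec_sum]
  exact Finset.sum_congr rfl fun i _ => h3 i

end Eigen

/-! ### Gauss--Borel factorizations -/

section GaussBorel

variable {M S Sbar : ℕ → ℕ → ℂ} {H : ℕ → ℂ}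

lemma IsGaussBorel.sum_fin_eq (h : IsGaussBorel M S Sbar H) {n : ℕ} (i j : Fin n) :
    ∑ k : Fin n, ∑ m : Fin n, S i k * M k m * Sbar j m = if i = j then H i else 0 := by
  have h1 := h.factor i j
  simp only [Fin.val_inj] at h1
  rw [← h1, ← Finset.sum_range fun k => ∑ m : Fin n, S i k * M k m * Sbar j m]
  symm
  rw [Finset.sum_subset (Finset.range_subset_range.2 i.2)]
  · refine Finset.sum_congr rfl fun k _ => ?_
    rw [← Finset.sum_range fun m => S i k * M k m * Sbar j m]
    refine Finset.sum_subset (Finset.range_subset_range.2 j.2) fun m _ hm => ?_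
    rw [h.lower_bar _ _ (by rw [Finset.mem_range] at hm; omega), mul_zero]
  · intro k _ hk
    refine Finset.sum_eq_zero fun m _ => ?_
    rw [h.lower _ _ (by rw [Finset.mem_range] at hk; omega), zero_mul, zero_mul]

/-- Triangularity restricts the factorization to leading n × n blocks; as all H i are nonzero, the
truncated moment matrix is invertible. -/
lemma IsGaussBorel.eq_zero_of_vecMul (h : IsGaussBorel M S Sbar H) {n : ℕ} {c : ℕ → ℂ}
    (hc : ∀ j < n, ∑ k ∈ Finset.range n, c k * M k j = 0) : ∀ k < n, c k = 0 := by
  set A : Matrix (Fin n) (Fin n) ℂ := of fun i j => S i j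
  set B : Matrix (Fin n) (Fin n) ℂ := of fun i j => M i j
  set D : Matrix (Fin n) (Fin n) ℂ := of fun i j => Sbar i j
  have hABD : A * B * Dᵀ = diagonal fun i : Fin n => H i := by
    ext i j
    rw [diagonal_apply, ← h.sum_fin_eq i j, mul_apply, Finset.sum_comm]
    refine Finset.sum_congr rfl fun m _ => ?_
    rw [mul_apply, Finset.sum_mul]
    rfl
  have hdet : B.det ≠ 0 := by
    intro h0
    have := congrArg det hABD
    rw [det_mul, det_mul, h0, mul_zero, zero_mul, det_diagonal] at this
    exact Finset.prod_ne_zero_iff.2 (fun (i : Fin n) _ => h.ne_zero i) this.symm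
  have hv : (fun k : Fin n => c k) ᵥ* B = 0 := by
    ext j
    rw [Pi.zero_apply, ← hc j j.2, Finset.sum_range]
    rfl
  have := eq_zero_of_vecMul_eq_zero hdet hv
  exact fun k hk => congrFun this ⟨k, hk⟩

/-- Orthogonality of row i of S to the lower monomials. The factorization gives it against the rows
of `Sbar`, and unitriangularity removes that factor by induction on j. -/
lemma IsGaussBorel.sum_mul_eq_zero (h : IsGaussBorel M S Sbar H) {i j : ℕ} (hij : j < i) :
    ∑ k ∈ Finset.range (i + 1), S i k * M k j = 0 := by
  induction j using Nat.strong_induction_on with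
  | _ j ih =>
    have h1 := h.factor i j
    rw [if_neg (by omega), Finset.sum_comm, Finset.sum_range_succ, Finset.sum_eq_zero, zero_add]
      at h1
    · simpa [h.diag_bar] using h1
    · intro m hm
      rw [Finset.mem_range] at hm
      rw [← Finset.sum_mul, ih m hm (by omega), zero_mul]

/-- The row vector `B_n` as a vector polynomial. -/
noncomputable def orthogonalVec (q : ℕ) (S : ℕ → ℕ → ℂ) (n : ℕ) : Fin q → ℂ[X] :=
  ∑ k ∈ Finset.range (n + 1), S n k • monomialVec q k

lemma evalVec_orthogonalVec (q : ℕ) (S : ℕ → ℕ → ℂ) (n : ℕ) (z : ℂ) :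
    evalVec (orthogonalVec q S n) z = B q S n z := by
  ext b
  simp only [evalVec, orthogonalVec, B, Finset.sum_apply, eval_finsetSum, Pi.smul_apply,
    eval_smul, smul_eq_mul, monomialVec, monomialMatrix]
  refine Finset.sum_congr rfl fun k _ => ?_
  split_ifs <;> simp

lemma orthogonalVec_mem_stepSpace {q : ℕ} [NeZero q] (S : ℕ → ℕ → ℂ) {m n : ℕ} (h : m < n) :
    orthogonalVec q S m ∈ stepSpace q n :=
  Submodule.sum_mem _ fun k hk => Submodule.smul_mem _ _
    (monomialVec_mem_stepSpace (by rw [Finset.mem_range] at hk; omega))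

/-- B_m has coordinate 1 at m, where all earlier B_k vanish; the largest index in a relation is thus
isolated. -/
lemma IsGaussBorel.linearIndependent_orthogonalVec {q : ℕ} [NeZero q]
    (h : IsGaussBorel M S Sbar H) : LinearIndependent ℂ (orthogonalVec q S) := by
  rw [linearIndependent_iff']
  intro s c hs
  by_contra! hne
  obtain ⟨i, his, hi⟩ := hne
  obtain ⟨m, hm, hmax⟩ := (s.filter fun i => c i ≠ 0).exists_max_image id
    ⟨i, Finset.mem_filter.2 ⟨his, hi⟩⟩
  rw [Finset.mem_filter] at hm
  have h1 := congrArg (stepCoord q m) hs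
  rw [map_sum, Finset.sum_eq_single m, map_smul, map_zero, orthogonalVec, map_sum,
    Finset.sum_eq_single m] at h1
  · rw [map_smul, stepCoord_monomialVec, if_pos rfl, h.diag] at h1
    exact hm.2 (by simpa using h1)
  · intro k _ hk
    rw [map_smul, stepCoord_monomialVec, if_neg hk.symm, smul_zero]
  · simp
  · intro k hk hkm
    rw [map_smul]
    by_cases hck : c k = 0
    · rw [hck, zero_smul]
    · have hle : k ≤ m := hmax k (Finset.mem_filter.2 ⟨hk, hck⟩)
      rw [mem_stepSpace.1 (orthogonalVec_mem_stepSpace S (lt_of_le_of_ne hle hkm)) m le_rfl,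
        smul_zero]
  · exact fun hm' => absurd hm.1 hm'

end GaussBorel

/-! ### Nonvanishing of the determinants for an abstract pairing -/

section Pairing

variable {p q : ℕ} {Φ : (Fin q → ℂ[X]) →ₗ[ℂ] (Fin p → ℂ[X]) →ₗ[ℂ] ℂ}

lemma eq_zero_of_pairing_eq_zero [NeZero q] {L : Matrix (Fin q) (Fin q) ℂ[X]} {d M : ℕ}
    (hL : ShiftsBy L d) {lam : Fin M → ℂ} (hlam : SimpleEigenvalues L lam) {w : Fin M → Fin q → ℂ}
    (hw : ∀ j, w j ≠ 0 ∧ evalAt L (lam j) *ᵥ w j = 0) {S Sbar : ℕ → ℕ → ℂ} {H : ℕ → ℂ}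
    (hS : IsGaussBorel (fun i j => Φ (monomialVec q i ᵥ* L) (monomialVec p j)) S Sbar H)
    {n : ℕ} {P : Fin q → ℂ[X]} (hP : P ∈ stepSpace q (n + M))
    (hPw : ∀ j, evalVec P (lam j) ⬝ᵥ w j = 0) (hΦ : ∀ j < n, Φ P (monomialVec p j) = 0) :
    P = 0 := by
  obtain ⟨Q, rfl⟩ := hlam.exists_eq_vecMul hw hPw
  have hM : M ≤ d := hlam.card_le.trans hL.natDegree_det_le
  have hQ := eq_sum_stepCoord (stepSpace_mono (by omega) (hL.mem_stepSpace hP) :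
    Q ∈ stepSpace q n)
  have h0 := hS.eq_zero_of_vecMul (n := n) (c := fun k => stepCoord q k Q) fun j hj => by
    rw [← hΦ j hj]
    conv_rhs => rw [hQ]
    simp [sum_vecMul, smul_vecMul]
  rw [hQ, Finset.sum_eq_zero, zero_vecMul]
  intro k hk
  rw [h0 k (Finset.mem_range.1 hk), zero_smul]

lemma pairing_orthogonalVec_mulVec_eq_zero [NeZero p] {R : Matrix (Fin p) (Fin p) ℂ[X]}
    {S Sbar : ℕ → ℕ → ℂ} {H : ℕ → ℂ}
    (hS : IsGaussBorel (fun i j => Φ (monomialVec q i) (R *ᵥ monomialVec p j)) S Sbar H)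
    {m : ℕ} {g : Fin p → ℂ[X]} (hg : g ∈ stepSpace p m) :
    Φ (orthogonalVec q S m) (R *ᵥ g) = 0 := by
  rw [eq_sum_stepCoord hg, mulVec_sum, map_sum]
  refine Finset.sum_eq_zero fun j hj => ?_
  rw [mulVec_smul, map_smul, orthogonalVec]
  have := hS.sum_mul_eq_zero (Finset.mem_range.1 hj)
  simp only [map_sum, map_smul, LinearMap.sum_apply, LinearMap.smul_apply, smul_eq_mul, this,
    mul_zero]

lemma pairing_eq_zero_of_eigenQuotient [NeZero p] {R : Matrix (Fin p) (Fin p) ℂ[X]} {d M : ℕ}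
    (hR : ShiftsBy Rᵀ d) {ρ : Fin M → ℂ} (hρ : SimpleEigenvalues R ρ) {w : Fin M → Fin p → ℂ}
    (hw : ∀ i, w i ≠ 0 ∧ evalAt R (ρ i) *ᵥ w i = 0) {n : ℕ} {φ : (Fin p → ℂ[X]) →ₗ[ℂ] ℂ}
    (hφ : ∀ g ∈ stepSpace p (n - M), φ (R *ᵥ g) = 0)
    (hφw : ∀ i, φ (eigenQuotient R (ρ i) (w i)) = 0) {f : Fin p → ℂ[X]}
    (hf : f ∈ stepSpace p n) : φ f = 0 := by
  have hM : M ≤ d := by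
    have := hρ.card_le
    rw [← det_transpose] at this
    exact this.trans hR.natDegree_det_le
  obtain ⟨c, g, rfl⟩ := hρ.exists_eq_sum_add_mulVec hw f
  -- Each quotient has order at most d, so R g = f - ∑ has order at most max n d. Removing the shift
  -- d leaves n - d (truncated) for g, and M ≤ d gives the bound n - M.
  have hsum : ∑ i, c i • eigenQuotient R (ρ i) (w i) ∈ stepSpace p (max n d) := by
    refine Submodule.sum_mem _ fun i _ => Submodule.smul_mem _ _ ?_
    refine stepSpace_mono (le_max_right n d) (mem_stepSpace_of_X_sub_C_smul (z := ρ i) ?_)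
    simp_rw [X_sub_C_mul_eigenQuotient (hw i).2]
    simpa using hR.mulVec_C_mem_stepSpace (w i)
  have hg : g ∈ stepSpace p (n - M) := by
    have h1 := (Submodule.add_mem_iff_right _ hsum).1 (stepSpace_mono (le_max_left n d) hf)
    rw [← vecMul_transpose] at h1
    exact stepSpace_mono (by omega) (hR.mem_stepSpace h1)
  rw [map_add, hφ g hg, add_zero, map_sum]
  exact Finset.sum_eq_zero fun i _ => by rw [map_smul, hφw, smul_zero]

end Pairing

/-! ### Integrals against matrix densities -/

section Integral

variable {p q : ℕ} {m : Measure ℝ} {F : ℝ → Matrix (Fin q) (Fin p) ℂ}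

lemma integrable_eval_mul {f : ℝ → ℂ} (hf : ∀ k : ℕ, Integrable (fun x : ℝ => (x : ℂ) ^ k * f x) m)
    (P : ℂ[X]) : Integrable (fun x : ℝ => P.eval (x : ℂ) * f x) m := by
  simp_rw [eval_eq_sum_range, Finset.sum_mul, mul_assoc]
  exact integrable_finsetSum _ fun k _ => (hf k).const_mul _

lemma vecMul_dotProduct_eq_sum (u : Fin q → ℂ) (G : Matrix (Fin q) (Fin p) ℂ) (v : Fin p → ℂ) :
    (u ᵥ* G) ⬝ᵥ v = ∑ a, ∑ b, (u b * v a) * G b a := by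
  simp only [dotProduct, vecMul, Finset.sum_mul]
  exact Finset.sum_congr rfl fun a _ => Finset.sum_congr rfl fun b _ => by ring

lemma integrable_evalVec_vecMul_dotProduct
    (hF : ∀ (k : ℕ) b a, Integrable (fun x : ℝ => (x : ℂ) ^ k * F x b a) m)
    (P : Fin q → ℂ[X]) (Q : Fin p → ℂ[X]) :
    Integrable (fun x : ℝ => (evalVec P x ᵥ* F x) ⬝ᵥ evalVec Q x) m := by
  simp_rw [vecMul_dotProduct_eq_sum, evalVec, ← eval_mul]
  exact integrable_finsetSum _ fun a _ => integrable_finsetSum _ fun b _ =>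
    integrable_eval_mul (fun k => hF k b a) _

lemma evalVec_add {n : ℕ} (P Q : Fin n → ℂ[X]) (z : ℂ) :
    evalVec (P + Q) z = evalVec P z + evalVec Q z := by
  ext
  simp [evalVec]

lemma evalVec_smul {n : ℕ} (c : ℂ) (P : Fin n → ℂ[X]) (z : ℂ) :
    evalVec (c • P) z = c • evalVec P z := by
  ext
  simp [evalVec]

/-- The bilinear form `∫ P(x) F(x) Q(x) dm(x)` on vector polynomials. -/
noncomputable def integralPairing
    (hF : ∀ (k : ℕ) b a, Integrable (fun x : ℝ => (x : ℂ) ^ k * F x b a) m) :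
    (Fin q → ℂ[X]) →ₗ[ℂ] (Fin p → ℂ[X]) →ₗ[ℂ] ℂ :=
  LinearMap.mk₂ ℂ (fun P Q => ∫ x : ℝ, (evalVec P x ᵥ* F x) ⬝ᵥ evalVec Q x ∂m)
    (fun P P' Q => by
      simp_rw [evalVec_add, add_vecMul, add_dotProduct]
      exact integral_add (integrable_evalVec_vecMul_dotProduct hF P Q)
        (integrable_evalVec_vecMul_dotProduct hF P' Q))
    (fun c P Q => by
      simp_rw [evalVec_smul, smul_vecMul, smul_dotProduct]
      exact integral_smul c _)
    (fun P Q Q' => by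
      simp_rw [evalVec_add, dotProduct_add]
      exact integral_add (integrable_evalVec_vecMul_dotProduct hF P Q)
        (integrable_evalVec_vecMul_dotProduct hF P Q'))
    (fun c P Q => by
      simp_rw [evalVec_smul, dotProduct_smul]
      exact integral_smul c _)

/-- The bilinear form `P(z) u v Q(z)` on vector polynomials. -/
noncomputable def pointPairing (z : ℂ) (u : Fin q → ℂ) (v : Fin p → ℂ) :
    (Fin q → ℂ[X]) →ₗ[ℂ] (Fin p → ℂ[X]) →ₗ[ℂ] ℂ :=
  LinearMap.mk₂ ℂ (fun P Q => (evalVec P z ⬝ᵥ u) * (v ⬝ᵥ evalVec Q z))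
    (fun P P' Q => by rw [evalVec_add, add_dotProduct, add_mul])
    (fun c P Q => by rw [evalVec_smul, smul_dotProduct, smul_mul_assoc])
    (fun P Q Q' => by rw [evalVec_add, dotProduct_add, mul_add])
    (fun c P Q => by rw [evalVec_smul, dotProduct_smul, mul_smul_comm])

/-- The bilinear form given by `dμ R⁻¹ + ∑ᵢ ξᵢ rᵢ δ(x - ρᵢ)` on vector polynomials. -/
noncomputable def uvarovPairing {MR : ℕ} {μ : Matrix (Fin q) (Fin p) (ComplexMeasure ℝ)}
    {R : Matrix (Fin p) (Fin p) ℂ[X]} (hdiv : RightDivisible μ R) (ρ : Fin MR → ℂ)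
    (rcov : Fin MR → Fin p → ℂ) (ξ : Fin MR → ℂ → Fin q → ℂ) :
    (Fin q → ℂ[X]) →ₗ[ℂ] (Fin p → ℂ[X]) →ₗ[ℂ] ℂ :=
  integralPairing hdiv.integrable + ∑ i, pointPairing (ρ i) (ξ i (ρ i)) (rcov i)

/-! ### Values of the Uvarov pairing. -/

variable {MR : ℕ} {μ : Matrix (Fin q) (Fin p) (ComplexMeasure ℝ)}
  {R : Matrix (Fin p) (Fin p) ℂ[X]} {hdiv : RightDivisible μ R} {ρ : Fin MR → ℂ}
  {rcov : Fin MR → Fin p → ℂ} {ξ : Fin MR → ℂ → Fin q → ℂ}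

lemma uvarovPairing_apply (P : Fin q → ℂ[X]) (Q : Fin p → ℂ[X]) :
    uvarovPairing hdiv ρ rcov ξ P Q =
      ∫ x : ℝ, (evalVec P x ᵥ* (density μ x * (evalAt R x)⁻¹)) ⬝ᵥ evalVec Q x ∂refMeasure μ +
        ∑ i, (evalVec P (ρ i) ⬝ᵥ ξ i (ρ i)) * (rcov i ⬝ᵥ evalVec Q (ρ i)) := by
  simp only [uvarovPairing, LinearMap.add_apply, LinearMap.sum_apply, integralPairing,
    pointPairing, LinearMap.mk₂_apply]

lemma evalVec_monomialVec (n k : ℕ) (z : ℂ) :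
    evalVec (monomialVec n k) z = monomialMatrix n z k := by
  ext b
  simp only [evalVec, monomialVec, monomialMatrix]
  split_ifs <;> simp

lemma monomialMatrix_eq_smul (n : ℕ) [NeZero n] (z : ℂ) (k : ℕ) :
    monomialMatrix n z k = z ^ (k / n) • Pi.single (Fin.ofNat n k) 1 := by
  ext b
  simp only [monomialMatrix, Pi.smul_apply, Pi.single_apply, Fin.ext_iff, Fin.ofNat, smul_eq_mul,
    mul_ite, mul_one, mul_zero, eq_comm]

lemma uvarovPairing_orthogonalVec_monomialVec (S : ℕ → ℕ → ℂ) (n j : ℕ) :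
    uvarovPairing hdiv ρ rcov ξ (orthogonalVec q S n) (monomialVec p j) =
      bbI μ R S ρ rcov ξ n j := by
  simp only [uvarovPairing_apply, evalVec_orthogonalVec, evalVec_monomialVec, bbI]

lemma uvarovPairing_mulVec (hrcov : ∀ i, rcov i ᵥ* evalAt R (ρ i) = 0) (P : Fin q → ℂ[X])
    (Q : Fin p → ℂ[X]) : uvarovPairing hdiv ρ rcov ξ P (R *ᵥ Q) =
      ∫ x : ℝ, (evalVec P x ᵥ* density μ x) ⬝ᵥ evalVec Q x ∂refMeasure μ := by
  rw [uvarovPairing_apply, Finset.sum_eq_zero, add_zero]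
  · refine integral_congr_ae ?_
    filter_upwards [hdiv.ae_ne_zero] with x hx
    rw [evalVec_mulVec, dotProduct_mulVec, vecMul_vecMul, Matrix.mul_assoc,
      nonsing_inv_mul _ (isUnit_iff_ne_zero.2 hx), Matrix.mul_one]
  · intro i _
    rw [evalVec_mulVec, dotProduct_mulVec, hrcov, zero_dotProduct, mul_zero]

lemma uvarovPairing_monomialVec_mulVec [NeZero p] [NeZero q]
    (hrcov : ∀ i, rcov i ᵥ* evalAt R (ρ i) = 0) (i j : ℕ) :
    uvarovPairing hdiv ρ rcov ξ (monomialVec q i) (R *ᵥ monomialVec p j) = momentMatrix μ i j := by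
  rw [uvarovPairing_mulVec hrcov, momentMatrix]
  congr 1
  ext x
  rw [evalVec_monomialVec, evalVec_monomialVec, monomialMatrix_eq_smul, monomialMatrix_eq_smul,
    smul_vecMul, smul_dotProduct, dotProduct_smul, dotProduct_single_one, single_one_vecMul,
    smul_eq_mul, smul_eq_mul, pow_add, mul_assoc]
  rfl

lemma uvarovPairing_monomialVec_vecMul [NeZero p] [NeZero q]
    (L : Matrix (Fin q) (Fin q) ℂ[X]) (i j : ℕ) :
    uvarovPairing hdiv ρ rcov ξ (monomialVec q i ᵥ* L) (monomialVec p j) =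
      perturbedMomentMatrix μ R L ρ rcov ξ i j := by
  rw [uvarovPairing_apply, perturbedMomentMatrix]
  congr 1
  · congr 1
    ext x
    rw [evalVec_vecMul, evalVec_monomialVec, evalVec_monomialVec, monomialMatrix_eq_smul,
      monomialMatrix_eq_smul, vecMul_vecMul, ← Matrix.mul_assoc,
      smul_vecMul, smul_dotProduct, dotProduct_smul, dotProduct_single_one, single_one_vecMul,
      smul_eq_mul, smul_eq_mul, pow_add, mul_assoc]
    rfl
  · refine Finset.sum_congr rfl fun s _ => ?_
    rw [evalVec_vecMul, evalVec_monomialVec, evalVec_monomialVec, monomialMatrix_eq_smul,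
      monomialMatrix_eq_smul, ← dotProduct_mulVec, smul_dotProduct, dotProduct_smul,
      dotProduct_single_one, single_one_dotProduct, smul_eq_mul, smul_eq_mul, pow_add]
    ring

/-- Differentiate (X - z) · quotient = R w and evaluate at z. -/
lemma evalVec_eigenQuotient_self {z : ℂ} {w : Fin p → ℂ} (h : evalAt R z *ᵥ w = 0) :
    evalVec (eigenQuotient R z w) z = evalAt (R.map derivative) z *ᵥ w := by
  ext b
  have h1 := congrArg (fun f => (derivative f).eval z) (X_sub_C_mul_eigenQuotient h b)
  simpa [evalVec, evalAt, mulVec, dotProduct, derivative_sum, eval_finsetSum] using h1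

lemma X_sub_C_smul_evalVec_eigenQuotient {z : ℂ} {w : Fin p → ℂ} (h : evalAt R z *ᵥ w = 0)
    (x : ℂ) : (x - z) • evalVec (eigenQuotient R z w) x = evalAt R x *ᵥ w := by
  have h1 := evalVec_mulVec R (fun i => C (w i)) x
  rw [evalVec_C] at h1
  rw [← h1]
  ext b
  simpa [evalVec] using congrArg (eval x) (X_sub_C_mul_eigenQuotient h b)

/-- Applying R⁻¹ to the quotient leaves rᵢ / (x - ρᵢ), which produces -𝔻. A mass at another ρₖ
contributes nothing, because its left eigenvector kills R(ρₖ) rᵢ; the mass at ρᵢ sees R'(ρᵢ) rᵢ and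
produces 𝕎. -/
lemma uvarovPairing_orthogonalVec_eigenQuotient (hinj : Function.Injective ρ)
    {rvec : Fin MR → Fin p → ℂ} (hrvec : ∀ i, rvec i ≠ 0 ∧ evalAt R (ρ i) *ᵥ rvec i = 0)
    (hrcov : ∀ i, rcov i ᵥ* evalAt R (ρ i) = 0) (S : ℕ → ℕ → ℂ) (n : ℕ) (i : Fin MR) :
    uvarovPairing hdiv ρ rcov ξ (orthogonalVec q S n) (eigenQuotient R (ρ i) (rvec i)) =
      -(bbD μ S ρ rvec n i - bbW R S ρ rvec rcov ξ n i) := by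
  rw [uvarovPairing_apply, neg_sub', bbD, bbW, sub_neg_eq_add, Finset.sum_eq_single i,
    evalVec_eigenQuotient_self (hrvec i).2, evalVec_orthogonalVec, ← integral_neg]
  · congr 1
    refine integral_congr_ae ?_
    filter_upwards [hdiv.ae_ne_zero] with x hx
    -- At x = ρᵢ the matrix R(x) would be singular, which holds only on a null set.
    have hne : (x : ℂ) - ρ i ≠ 0 := by
      intro h0
      rw [sub_eq_zero] at h0
      rw [h0] at hx
      exact (hrvec i).1 (eq_zero_of_mulVec_eq_zero hx (hrvec i).2)
    have h1 : (evalAt R x)⁻¹ *ᵥ evalVec (eigenQuotient R (ρ i) (rvec i)) x =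
        ((x : ℂ) - ρ i)⁻¹ • rvec i := by
      rw [eq_inv_smul_iff₀ hne, ← mulVec_smul, X_sub_C_smul_evalVec_eigenQuotient (hrvec i).2,
        mulVec_mulVec, nonsing_inv_mul _ (isUnit_iff_ne_zero.2 hx), one_mulVec]
    rw [← vecMul_vecMul, ← dotProduct_mulVec, h1, dotProduct_smul, smul_eq_mul,
      evalVec_orthogonalVec, ← neg_sub (x : ℂ), div_neg, neg_neg, div_eq_inv_mul]
  · intro k _ hki
    have h1 := congrArg (rcov k ⬝ᵥ ·) (X_sub_C_smul_evalVec_eigenQuotient (hrvec i).2 (ρ k))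
    simp only [dotProduct_smul, dotProduct_mulVec, hrcov, zero_dotProduct, smul_eq_mul,
      mul_eq_zero, sub_eq_zero] at h1
    rw [h1.resolve_left fun h => hki (hinj h), mul_zero]
  · simp

end Integral

end Uvarov

/-! ### Nonvanishing of the tau determinants. -/

theorem mainTheorem2 {p q : ℕ} [NeZero p] [NeZero q]
    (μ : Matrix (Fin q) (Fin p) (ComplexMeasure ℝ))
    (hμ : ∀ (k : ℕ) (b : Fin q) (a : Fin p),
      Integrable (fun x : ℝ => (x : ℂ) ^ k * Uvarov.density μ x b a) (Uvarov.refMeasure μ))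
    (R : Matrix (Fin p) (Fin p) ℂ[X]) (NR r : ℕ) (hR : Uvarov.RightLeading R NR r)
    (L : Matrix (Fin q) (Fin q) ℂ[X]) (NL l : ℕ) (hL : Uvarov.LeftLeading L NL l)
    {MR ML : ℕ}
    (ρ : Fin MR → ℂ) (hρ : Uvarov.SimpleEigenvalues R ρ)
    (lam : Fin ML → ℂ) (hlam : Uvarov.SimpleEigenvalues L lam)
    (rvec : Fin MR → Fin p → ℂ)
    (hrvec : ∀ i, rvec i ≠ 0 ∧ Uvarov.evalAt R (ρ i) *ᵥ rvec i = 0)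
    (rcov : Fin MR → Fin p → ℂ)
    (hrcov : ∀ i, rcov i ≠ 0 ∧ rcov i ᵥ* Uvarov.evalAt R (ρ i) = 0)
    (lvec : Fin ML → Fin q → ℂ)
    (hlvec : ∀ j, lvec j ≠ 0 ∧ Uvarov.evalAt L (lam j) *ᵥ lvec j = 0)
    (ξ : Fin MR → ℂ → Fin q → ℂ)
    (hdiv : Uvarov.RightDivisible μ R)
    (S Sbar : ℕ → ℕ → ℂ) (H : ℕ → ℂ)
    (hS : Uvarov.IsGaussBorel (Uvarov.momentMatrix μ) S Sbar H)
    (hpert : ∃ (S' Sbar' : ℕ → ℕ → ℂ) (H' : ℕ → ℂ), Uvarov.IsGaussBorel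
      (Uvarov.perturbedMomentMatrix μ R L ρ rcov ξ) S' Sbar' H') :
    (∀ n, MR ≤ n → Uvarov.tau μ R S ρ lam rvec rcov lvec ξ n ≠ 0) ∧
      (∀ n, n < MR → Uvarov.tauSmall μ R S ρ lam rcov lvec ξ n ≠ 0) := by
  obtain ⟨S', Sbar', H', hS'⟩ := hpert
  have hcov := fun i => (hrcov i).2
  have hM : Uvarov.momentMatrix μ = fun i j => Uvarov.uvarovPairing hdiv ρ rcov ξ
      (Uvarov.monomialVec q i) (R *ᵥ Uvarov.monomialVec p j) := by
    ext i j
    exact (Uvarov.uvarovPairing_monomialVec_mulVec hcov i j).symm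
  have hM' : Uvarov.perturbedMomentMatrix μ R L ρ rcov ξ = fun i j =>
      Uvarov.uvarovPairing hdiv ρ rcov ξ (Uvarov.monomialVec q i ᵥ* L)
        (Uvarov.monomialVec p j) := by
    ext i j
    exact (Uvarov.uvarovPairing_monomialVec_vecMul L i j).symm
  have hind := hS.linearIndependent_orthogonalVec (q := q)
  rw [hM'] at hS'
  rw [hM] at hS
  have hbbB : ∀ m j, Uvarov.bbB S lam lvec m j =
      Uvarov.evalVec (Uvarov.orthogonalVec q S m) (lam j) ⬝ᵥ lvec j := fun m j => by
    rw [Uvarov.evalVec_orthogonalVec, Uvarov.bbB]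
  have heval : ∀ {N : ℕ} (c : Fin N → ℂ) (g : Fin N → ℕ) (j : Fin ML),
      Uvarov.evalVec (∑ k, c k • Uvarov.orthogonalVec q S (g k)) (lam j) ⬝ᵥ lvec j =
        ∑ k, c k * Uvarov.bbB S lam lvec (g k) j := fun c g j => by
    -- Writing the evaluation as a bilinear form with a dummy second argument, contributing the
    -- factor 1, makes its linearity in P available.
    have : ∀ P, Uvarov.evalVec P (lam j) ⬝ᵥ lvec j =
        Uvarov.pointPairing (p := p) (lam j) (lvec j) (Pi.single 0 1)
          P (fun _ => C 1) := fun P => by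
      simp [Uvarov.pointPairing, Uvarov.evalVec]
    simp only [hbbB, this, map_sum, map_smul, LinearMap.sum_apply, LinearMap.smul_apply,
      smul_eq_mul]
  have hpair : ∀ {N : ℕ} (c : Fin N → ℂ) (g : Fin N → ℕ) (f : Fin p → ℂ[X]),
      Uvarov.uvarovPairing hdiv ρ rcov ξ (∑ k, c k • Uvarov.orthogonalVec q S (g k)) f =
        ∑ k, c k * Uvarov.uvarovPairing hdiv ρ rcov ξ (Uvarov.orthogonalVec q S (g k)) f :=
    fun c g f => by simp [LinearMap.sum_apply]
  constructor
  · intro n hn h0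
    obtain ⟨c, hc0, hc⟩ := exists_vecMul_eq_zero_iff.2 h0
    have hcl : ∀ j, ∑ k, c k * Uvarov.bbB S lam lvec (n - MR + k) j = 0 := fun j => by
      simpa [vecMul, dotProduct] using congrFun hc (Fin.castAdd MR j)
    have hcr : ∀ i, ∑ k, c k * (Uvarov.bbD μ S ρ rvec (n - MR + k) i -
        Uvarov.bbW R S ρ rvec rcov ξ (n - MR + k) i) = 0 := fun i => by
      simpa [vecMul, dotProduct] using congrFun hc (Fin.natAdd ML i)
    have hP : ∑ k, c k • Uvarov.orthogonalVec q S (n - MR + k) = 0 := by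
      refine Uvarov.eq_zero_of_pairing_eq_zero hL.shiftsBy hlam hlvec hS' (n := n) ?_ ?_ ?_
      · exact Submodule.sum_mem _ fun k _ => Submodule.smul_mem _ _
          (Uvarov.orthogonalVec_mem_stepSpace S (by omega))
      · exact fun j => by rw [heval, hcl]
      · refine fun j hj => Uvarov.pairing_eq_zero_of_eigenQuotient hR.transpose.shiftsBy hρ hrvec
          ?_ ?_ (Uvarov.monomialVec_mem_stepSpace hj)
        · intro g hg
          rw [hpair]
          -- Every B_m in the combination has m ≥ n - MR, so each is separately orthogonal to R g.
          refine Finset.sum_eq_zero fun k _ => ?_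
          rw [Uvarov.pairing_orthogonalVec_mulVec_eq_zero hS
            (Uvarov.stepSpace_mono (Nat.le_add_right _ _) hg), mul_zero]
        · intro i
          rw [hpair]
          simp_rw [Uvarov.uvarovPairing_orthogonalVec_eigenQuotient hρ.injective hrvec hcov,
            mul_neg, Finset.sum_neg_distrib, hcr, neg_zero]
    refine hc0 (funext (Fintype.linearIndependent_iff.1 (hind.comp
      (fun k : Fin (ML + MR) => n - MR + (k : ℕ)) fun a b hab => ?_) c hP))
    exact Fin.ext (Nat.add_left_cancel hab)
  · intro n _ h0
    obtain ⟨c, hc0, hc⟩ := exists_vecMul_eq_zero_iff.2 h0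
    have hcl : ∀ j, ∑ k, c k * Uvarov.bbB S lam lvec k j = 0 := fun j => by
      simpa [vecMul, dotProduct] using congrFun hc (Fin.castAdd n j)
    have hcr : ∀ j : Fin n, ∑ k, c k * Uvarov.bbI μ R S ρ rcov ξ k j = 0 := fun j => by
      simpa [vecMul, dotProduct] using congrFun hc (Fin.natAdd ML j)
    have hP : ∑ k, c k • Uvarov.orthogonalVec q S k = 0 := by
      refine Uvarov.eq_zero_of_pairing_eq_zero hL.shiftsBy hlam hlvec hS' (n := n) ?_ ?_ ?_
      · exact Submodule.sum_mem _ fun k _ => Submodule.smul_mem _ _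
          (Uvarov.orthogonalVec_mem_stepSpace S (by omega))
      · exact fun j => by rw [heval, hcl]
      -- For n < MR no spanning argument is needed: the entries 𝕀 are already the pairings with the
      -- first n monomials.
      · intro j hj
        rw [hpair]
        simp_rw [Uvarov.uvarovPairing_orthogonalVec_monomialVec]
        exact hcr ⟨j, hj⟩
    exact hc0 (funext (Fintype.linearIndependent_iff.1 (hind.comp
      (fun k : Fin (ML + n) => (k : ℕ)) Fin.val_injective) c hP))
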